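/- Consider the black-box model in which a (deterministic, adaptive) algorithm accesses a continuously differentiable function $f:[0,1]^d\to[0,1]$ only through an oracle that, queried at a point $x\in[0,1]^d$, returns the value $f(x)$ and the gradient $\nabla f(x)$; computations between queries are exact and not counted. Call $f$ $G$-Lipschitz if $|f(x)-f(y)|\le G\|x-y\|_2$, and $L$-smooth if $\|\nabla f(x)-\nabla f(y)\|_2\le L\|x-y\|_2$, for all $x,y\in[0,1]^d$. A point $x^\star\in[0,1]^d$ is an $(\varepsilon,\delta)$-local minimum of $f$ if $f(x^\star)<f(x)+\varepsilon$ for every $x\in[0,1]^d$ with $\|x-x^\star\|_2\le\delta$. **Theorem.** In the worst case, $\Omega(2^d/d)$ value/gradient queries are needed to find an $(\varepsilon,\delta)$-local minimum with $\delta=\sqrt d$ and $0<\varepsilon<1$ of a $G$-Lipschitz and $L$-smooth function $f:[0,1]^d\to[0,1]$, where $G=\Theta(d^{15})$ and $L=\Theta(d^{22})$. That is, there is an absolute constant $c>0$ such that, for all positive $G=G(d)=\Theta(d^{15})$ and $L=L(d)=\Theta(d^{22})$, the following holds for all sufficiently large $d$ and all $\varepsilon\in(0,1)$: every algorithm that,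 on every $G$-Lipschitz and $L$-smooth function $f:[0,1]^d\to[0,1]$, stops after finitely many queries and outputs an $(\varepsilon,\sqrt d)$-local minimum of $f$, makes at least $c\,2^d/d$ queries on some such function $f$. -/

import Mathlib

open Filter Asymptotics

namespace BlackBox

/-- The box `[0,1]^d` in Euclidean space (with the `ℓ₂` norm). -/
def cube (d : ℕ) : Set (EuclideanSpace ℝ (Fin d)) :=
  {x | ∀ i, x i ∈ Set.Icc (0 : ℝ) 1}

/-- The gradient of a function on `[0,1]^d`; at boundary points it is the gradient relative to the
box, which is unique there because the box is convex with nonempty interior. -/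
noncomputable def cubeGradient {d : ℕ} (f : EuclideanSpace ℝ (Fin d) → ℝ)
    (x : EuclideanSpace ℝ (Fin d)) : EuclideanSpace ℝ (Fin d) :=
  gradientWithin f (cube d) x

/-- `f` restricts to a continuously differentiable, `G`-Lipschitz and `L`-smooth function
`[0,1]^d → [0,1]`. Only the values of `f` on the box matter. -/
structure IsInstance {d : ℕ} (G L : ℝ) (f : EuclideanSpace ℝ (Fin d) → ℝ) : Prop where
  mapsTo : ∀ x ∈ cube d, f x ∈ Set.Icc (0 : ℝ) 1
  contDiffOn : ContDiffOn ℝ 1 f (cube d)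
  lipschitz : ∀ x ∈ cube d, ∀ y ∈ cube d, |f x - f y| ≤ G * ‖x - y‖
  smooth : ∀ x ∈ cube d, ∀ y ∈ cube d,
    ‖cubeGradient f x - cubeGradient f y‖ ≤ L * ‖x - y‖

/-- `x` is an `(ε, δ)`-local minimum of `f` constrained on `K`. -/
def IsApproxLocalMin {d : ℕ} (f : EuclideanSpace ℝ (Fin d) → ℝ)
    (K : Set (EuclideanSpace ℝ (Fin d))) (ε δ : ℝ) (x : EuclideanSpace ℝ (Fin d)) : Prop :=
  x ∈ K ∧ ∀ y ∈ K, y ∈ Metric.closedBall x δ → f x < f y + ε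

/-- One query to the oracle, together with its answer. -/
structure QueryRecord (d : ℕ) where
  point : cube d
  value : ℝ
  gradient : EuclideanSpace ℝ (Fin d)

/-- The query of the value/gradient oracle of `f` at `x`. -/
noncomputable def oracle {d : ℕ} (f : EuclideanSpace ℝ (Fin d) → ℝ) (x : cube d) :
    QueryRecord d where
  point := x
  value := f x
  gradient := cubeGradient f x

/-- A deterministic adaptive query algorithm: from the list of all queries and answers so far it
either chooses the next query point (`Sum.inl`) or stops with an output (`Sum.inr`). Computation
between queries is free and exact. -/
abbrev Algorithm (d : ℕ) : Type :=
  List (QueryRecord d) → cube d ⊕ EuclideanSpace ℝ (Fin d)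

namespace Algorithm

/-- The queries and answers after `n` steps of the run of `A` on `f`, oldest first; the run stays
put once `A` has stopped. -/
noncomputable def transcript {d : ℕ} (A : Algorithm d) (f : EuclideanSpace ℝ (Fin d) → ℝ) :
    ℕ → List (QueryRecord d)
  | 0 => []
  | n + 1 =>
    match A (transcript A f n) with
    | Sum.inl x => transcript A f n ++ [oracle f x]
    | Sum.inr _ => transcript A f n

/-- On `f`, the algorithm `A` makes exactly `n` queries and then stops with output `x`. -/
def OutputsAfter {d : ℕ} (A : Algorithm d) (f : EuclideanSpace ℝ (Fin d) → ℝ) (n : ℕ)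
    (x : EuclideanSpace ℝ (Fin d)) : Prop :=
  (∀ m < n, (A (A.transcript f m)).isLeft = true) ∧ A (A.transcript f n) = Sum.inr x

/-- `A` solves `LocalMin` on `[0,1]^d` in the black-box model: on every instance it stops after
finitely many queries, with an `(ε, δ)`-local minimum as output. -/
def SolvesLocalMin {d : ℕ} (A : Algorithm d) (G L ε δ : ℝ) : Prop :=
  ∀ f : EuclideanSpace ℝ (Fin d) → ℝ, IsInstance G L f →
    ∃ (n : ℕ) (x : EuclideanSpace ℝ (Fin d)),
      A.OutputsAfter f n x ∧ IsApproxLocalMin f (cube d) ε δ x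

end Algorithm

end BlackBox

/-!
The radius `√d` is the diameter of the box, so an approximate local minimum has to be an approximate
global minimum, and a resisting-oracle argument applies. Every vertex `v` of the box is the centre
of the well `x ↦ 1 - max 0 (1 - 4 ‖x - v‖²)²`, which vanishes at `v` and is `1`, with zero gradient,
at distance at least `1/2` from `v`. The open balls of radius `1/2` around the `2 ^ d` vertices are
pairwise disjoint (`eq_nearestVertex_of_norm_lt`). If the algorithm makes `n` queries on the constant
function `1` and `n + 1 < 2 ^ d`, some ball contains neither a query nor the output. The run on the
well in that ball is then the same (`transcript_congr`), so the output has value `1` there, while the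
minimum is `0`; this is not good enough as `ε < 1`. Hence `2 ^ d - 1` queries are made on the
constant function.

The Lipschitz and smoothness constants of a well on the box are at most linear in `d`
(`isInstance_well`), well below any functions of orders `d ^ 15` and `d ^ 22` once `d` is large.
-/

namespace BlackBox

/-! ### Differentiation relative to the box -/

lemma uniqueDiffOn_cube (d : ℕ) : UniqueDiffOn ℝ (cube d) := by
  have h : UniqueDiffOn ℝ (Set.univ.pi fun _ : Fin d => Set.Icc (0 : ℝ) 1) :=
    UniqueDiffOn.univ_pi fun _ => uniqueDiffOn_Icc zero_lt_one
  have h' := (EuclideanSpace.equiv (Fin d) ℝ).uniqueDiffOn_preimage_iff.2 h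
  have hcube : cube d = EuclideanSpace.equiv (Fin d) ℝ ⁻¹' Set.univ.pi fun _ => Set.Icc 0 1 := by
    ext x
    simp only [cube, Set.mem_ofPred_eq, Set.mem_preimage, Set.mem_univ_pi]
    rfl
  rw [hcube]
  exact h'

lemma cubeGradient_eq {d : ℕ} {f : EuclideanSpace ℝ (Fin d) → ℝ}
    {x g : EuclideanSpace ℝ (Fin d)} (hx : x ∈ cube d) (h : HasGradientAt f g x) :
    cubeGradient f x = g := by
  have h' := h.hasFDerivAt.hasFDerivWithinAt (s := cube d)
  rw [cubeGradient, gradientWithin, h'.fderivWithin (uniqueDiffOn_cube d x hx)]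
  simp

lemma norm_sub_le_sqrt_of_mem_cube {d : ℕ} {x y : EuclideanSpace ℝ (Fin d)}
    (hx : x ∈ cube d) (hy : y ∈ cube d) : ‖x - y‖ ≤ √d := by
  rw [EuclideanSpace.norm_eq]
  refine Real.sqrt_le_sqrt ?_
  calc ∑ i, ‖(x - y) i‖ ^ 2 ≤ ∑ _i : Fin d, (1 : ℝ) := by
        refine Finset.sum_le_sum fun i _ => ?_
        obtain ⟨h1, h2⟩ := hx i
        obtain ⟨h3, h4⟩ := hy i
        rw [Real.norm_eq_abs, sq_abs, PiLp.sub_apply]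
        nlinarith
    _ = d := by simp

lemma isInstance_const_one {d : ℕ} {G L : ℝ} (hG : 0 ≤ G) (hL : 0 ≤ L) :
    IsInstance G L (fun _ : EuclideanSpace ℝ (Fin d) => (1 : ℝ)) where
  mapsTo _ _ := by simp
  contDiffOn := contDiffOn_const
  lipschitz x _ y _ := by simpa using mul_nonneg hG (norm_nonneg (x - y))
  smooth x hx y hy := by
    rw [cubeGradient_eq hx (hasGradientAt_const x 1), cubeGradient_eq hy (hasGradientAt_const y 1)]
    simpa using mul_nonneg hL (norm_nonneg (x - y))

/-! ### Wells -/

/-- The profile `max 0 (1 - 4 ‖u‖²)`, supported in the ball of radius `1/2`. -/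
noncomputable def wellProfile {d : ℕ} (u : EuclideanSpace ℝ (Fin d)) : ℝ :=
  max 0 (1 - 4 * ‖u‖ ^ 2)

/-- The well centred at `v`: it is `0` at `v` and `1` at distance at least `1/2` from `v`. Squaring
the profile makes it continuously differentiable. -/
noncomputable def well {d : ℕ} (v x : EuclideanSpace ℝ (Fin d)) : ℝ :=
  1 - wellProfile (x - v) ^ 2

section

variable {d : ℕ}

lemma wellProfile_nonneg (u : EuclideanSpace ℝ (Fin d)) : 0 ≤ wellProfile u :=
  le_max_left _ _

lemma wellProfile_le_one (u : EuclideanSpace ℝ (Fin d)) : wellProfile u ≤ 1 :=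
  max_le zero_le_one (by nlinarith [sq_nonneg ‖u‖])

lemma wellProfile_eq_zero {u : EuclideanSpace ℝ (Fin d)} (hu : 1 / 2 ≤ ‖u‖) :
    wellProfile u = 0 :=
  max_eq_left (by nlinarith)

lemma continuous_wellProfile : Continuous (wellProfile (d := d)) := by
  unfold wellProfile
  fun_prop

lemma well_self (v : EuclideanSpace ℝ (Fin d)) : well v v = 0 := by
  simp [well, wellProfile]

lemma well_eq_one {v x : EuclideanSpace ℝ (Fin d)} (h : 1 / 2 ≤ ‖x - v‖) : well v x = 1 := by
  simp [well, wellProfile_eq_zero h]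

lemma hasDerivAt_max_zero_sq (s : ℝ) :
    HasDerivAt (fun t : ℝ => max 0 t ^ 2) (2 * max 0 s) s := by
  rcases lt_trichotomy s 0 with hs | rfl | hs
  · rw [max_eq_left hs.le, mul_zero]
    refine (hasDerivAt_const s (0 : ℝ)).congr_of_eventuallyEq ?_
    filter_upwards [Iio_mem_nhds hs] with t ht
    simp [max_eq_left (le_of_lt (Set.mem_Iio.1 ht))]
  · rw [max_self, mul_zero, hasDerivAt_iff_isLittleO]
    have h : (fun t : ℝ => max 0 t ^ 2) =O[nhds 0] fun t : ℝ => t ^ 2 := by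
      refine IsBigO.of_bound 1 (Eventually.of_forall fun t => ?_)
      rw [one_mul, norm_pow, norm_pow]
      refine pow_le_pow_left₀ (norm_nonneg _) ?_ 2
      rcases le_total 0 t with ht | ht <;> simp [ht]
    have h' : (fun t : ℝ => t ^ 2) =o[nhds 0] fun t : ℝ => t := by
      simpa using isLittleO_pow_id (𝕜 := ℝ) (n := 2) (by norm_num)
    simpa using h.trans_isLittleO h'
  · rw [max_eq_right hs.le]
    have h : HasDerivAt (fun t : ℝ => t ^ 2) (2 * s) s := by
      simpa using hasDerivAt_pow 2 s
    refine h.congr_of_eventuallyEq ?_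
    filter_upwards [Ioi_mem_nhds hs] with t ht
    simp [max_eq_right (le_of_lt (Set.mem_Ioi.1 ht))]

lemma hasGradientAt_well (v x : EuclideanSpace ℝ (Fin d)) :
    HasGradientAt (well v) ((16 * wellProfile (x - v)) • (x - v)) x := by
  have h1 : HasFDerivAt (fun y : EuclideanSpace ℝ (Fin d) => 1 - 4 * ‖y - v‖ ^ 2)
      (-((4 : ℝ) • (2 • (innerSL ℝ (x - v))))) x := by
    have := ((hasFDerivAt_id x).sub_const v).norm_sq
    simpa using (this.const_mul (4 : ℝ)).const_sub 1
  have h2 := ((hasDerivAt_max_zero_sq (1 - 4 * ‖x - v‖ ^ 2)).comp_hasFDerivAt x h1).const_sub 1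
  rw [hasGradientAt_iff_hasFDerivAt]
  refine HasFDerivAt.congr_fderiv h2 ?_
  ext w
  simp [wellProfile]
  ring

lemma contDiff_well (v : EuclideanSpace ℝ (Fin d)) : ContDiff ℝ 1 (well v) := by
  rw [contDiff_one_iff_hasFDerivAt]
  refine ⟨_, ?_, fun x => (hasGradientAt_well v x).hasFDerivAt⟩
  have := continuous_wellProfile (d := d)
  fun_prop

lemma abs_wellProfile_sub_le (u w : EuclideanSpace ℝ (Fin d)) :
    |wellProfile u - wellProfile w| ≤ 4 * (‖u‖ + ‖w‖) * ‖u - w‖ := by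
  calc |wellProfile u - wellProfile w|
      ≤ |(1 - 4 * ‖u‖ ^ 2) - (1 - 4 * ‖w‖ ^ 2)| := by
        unfold wellProfile
        rw [max_comm 0, max_comm 0]
        exact abs_max_sub_max_le_abs _ _ _
    _ = 4 * (‖u‖ + ‖w‖) * |‖u‖ - ‖w‖| := by
        rw [← abs_of_nonneg (show 0 ≤ 4 * (‖u‖ + ‖w‖) by positivity), ← abs_mul, abs_sub_comm]
        congr 1
        ring
    _ ≤ 4 * (‖u‖ + ‖w‖) * ‖u - w‖ := by
        gcongr
        exact abs_norm_sub_norm_le u w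

/-- Wells are instances as soon as both constants exceed a fixed multiple of `d`. -/
lemma isInstance_well {G L : ℝ} {v : EuclideanSpace ℝ (Fin d)} (hv : v ∈ cube d) (hd : 1 ≤ d)
    (hG : 144 * (d : ℝ) ≤ G) (hL : 144 * (d : ℝ) ≤ L) : IsInstance G L (well v) := by
  have hd' : (1 : ℝ) ≤ d := by exact_mod_cast hd
  have hsq : √(d : ℝ) ^ 2 = d := Real.sq_sqrt (by positivity)
  have hsd : √(d : ℝ) ≤ d := by nlinarith [Real.one_le_sqrt.2 hd']
  have hprof : ∀ x ∈ cube d, ∀ y ∈ cube d,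
      |wellProfile (x - v) - wellProfile (y - v)| ≤ 8 * √d * ‖x - y‖ := fun x hx y hy => by
    have h := abs_wellProfile_sub_le (x - v) (y - v)
    rw [sub_sub_sub_cancel_right] at h
    refine h.trans (mul_le_mul_of_nonneg_right ?_ (norm_nonneg _))
    linarith [norm_sub_le_sqrt_of_mem_cube hx hv, norm_sub_le_sqrt_of_mem_cube hy hv]
  refine ⟨fun x _ => ?_, (contDiff_well v).contDiffOn, fun x hx y hy => ?_, fun x hx y hy => ?_⟩
  · have h0 := wellProfile_nonneg (x - v)
    have h1 := wellProfile_le_one (x - v)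
    constructor <;> unfold well <;> nlinarith
  · have hx0 := wellProfile_nonneg (x - v)
    have hx1 := wellProfile_le_one (x - v)
    have hy0 := wellProfile_nonneg (y - v)
    have hy1 := wellProfile_le_one (y - v)
    calc |well v x - well v y|
        = (wellProfile (x - v) + wellProfile (y - v)) *
            |wellProfile (x - v) - wellProfile (y - v)| := by
          rw [← abs_of_nonneg (add_nonneg hx0 hy0), ← abs_mul, abs_sub_comm]
          unfold well
          congr 1
          ring
      _ ≤ 2 * (8 * √d * ‖x - y‖) := by
          gcongr
          · linarith
          · exact hprof x hx y hy
      _ = 16 * √d * ‖x - y‖ := by ring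
      _ ≤ G * ‖x - y‖ := by
          gcongr
          linarith
  · rw [cubeGradient_eq hx (hasGradientAt_well v x), cubeGradient_eq hy (hasGradientAt_well v y)]
    -- Changing one factor of `wellProfile u • u` at a time bounds the change of the gradient.
    have hsplit : (16 * wellProfile (x - v)) • (x - v) - (16 * wellProfile (y - v)) • (y - v) =
        (16 : ℝ) • (wellProfile (x - v) • (x - y) +
          (wellProfile (x - v) - wellProfile (y - v)) • (y - v)) := by
      module
    calc _ ≤ 16 * (wellProfile (x - v) * ‖x - y‖ +
          |wellProfile (x - v) - wellProfile (y - v)| * ‖y - v‖) := by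
          rw [hsplit, norm_smul, Real.norm_of_nonneg (by norm_num : (0 : ℝ) ≤ 16)]
          gcongr
          refine (norm_add_le _ _).trans_eq ?_
          rw [norm_smul, norm_smul, Real.norm_of_nonneg (wellProfile_nonneg _), Real.norm_eq_abs]
      _ ≤ 16 * (1 * ‖x - y‖ + 8 * √d * ‖x - y‖ * √d) := by
          gcongr
          · exact wellProfile_le_one _
          · exact hprof x hx y hy
          · exact norm_sub_le_sqrt_of_mem_cube hy hv
      _ = (16 + 128 * √(d : ℝ) ^ 2) * ‖x - y‖ := by ring
      _ ≤ L * ‖x - y‖ := by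
          rw [hsq]
          gcongr
          linarith

/-- Far from its centre, a well is indistinguishable from the constant function `1`. -/
lemma oracle_well_eq {v : EuclideanSpace ℝ (Fin d)} {x : cube d}
    (h : 1 / 2 ≤ ‖(x : EuclideanSpace ℝ (Fin d)) - v‖) :
    oracle (well v) x = oracle (fun _ => (1 : ℝ)) x := by
  simp only [oracle, well_eq_one h, cubeGradient_eq x.2 (hasGradientAt_well v x),
    cubeGradient_eq x.2 (hasGradientAt_const (x : EuclideanSpace ℝ (Fin d)) (1 : ℝ)),
    wellProfile_eq_zero h, mul_zero, zero_smul]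

/-! ### Vertices of the box -/

/-- The vertex of the box with coordinates `1` on the set indicated by `b` and `0` elsewhere. -/
noncomputable def vertex (b : Fin d → Bool) : EuclideanSpace ℝ (Fin d) :=
  WithLp.toLp 2 fun i => if b i then 1 else 0

lemma vertex_mem_cube (b : Fin d → Bool) : vertex b ∈ cube d := fun i => by
  by_cases h : b i <;> simp [vertex, h]

/-- The index of a vertex nearest to `x`, by rounding coordinates. -/
noncomputable def nearestVertex (x : EuclideanSpace ℝ (Fin d)) : Fin d → Bool :=
  fun i => decide (1 / 2 < x i)

lemma eq_nearestVertex_of_norm_lt {b : Fin d → Bool} {x : EuclideanSpace ℝ (Fin d)}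
    (h : ‖x - vertex b‖ < 1 / 2) : b = nearestVertex x := by
  funext i
  have hi : |x i - vertex b i| < 1 / 2 := (PiLp.norm_apply_le (x - vertex b) i).trans_lt h
  rw [abs_lt] at hi
  by_cases hb : b i
  · simp only [vertex, hb, if_true] at hi
    simp only [nearestVertex, hb]
    exact (decide_eq_true (by linarith [hi.1])).symm
  · simp only [vertex, hb] at hi
    simp only [nearestVertex, hb]
    refine (decide_eq_false ?_).symm
    simp only [Bool.false_eq_true, if_false] at hi
    linarith [hi.2]

/-- Fewer than `2 ^ d` points leave some vertex with no point at distance less than `1/2`. -/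
lemma exists_vertex_far (l : List (EuclideanSpace ℝ (Fin d))) (hl : l.length < 2 ^ d) :
    ∃ b : Fin d → Bool, ∀ x ∈ l, 1 / 2 ≤ ‖x - vertex b‖ := by
  have hcard : (l.map nearestVertex).toFinset.card < (Finset.univ : Finset (Fin d → Bool)).card :=
    (List.toFinset_card_le _).trans_lt (by simpa using hl)
  obtain ⟨b, -, hb⟩ := Finset.exists_mem_notMem_of_card_lt_card hcard
  refine ⟨b, fun x hx => ?_⟩
  by_contra! h
  exact hb (List.mem_toFinset.2 (List.mem_map.2 ⟨x, hx, (eq_nearestVertex_of_norm_lt h).symm⟩))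

/-! ### Runs of an algorithm -/

namespace Algorithm

variable (A : Algorithm d) (f g : EuclideanSpace ℝ (Fin d) → ℝ)

lemma length_transcript_le (n : ℕ) : (A.transcript f n).length ≤ n := by
  induction n with
  | zero => simp [transcript]
  | succ n ih =>
    rw [transcript]
    split
    · simpa using ih
    · exact ih.trans n.le_succ

lemma transcript_subset_succ (n : ℕ) : A.transcript f n ⊆ A.transcript f (n + 1) := by
  rw [transcript]
  split
  · exact List.subset_append_left _ _
  · exact List.Subset.refl _

variable {f g}

/-- Two functions with the same oracle answers on the queries of a run have the same run. -/
lemma transcript_congr {n : ℕ}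
    (h : ∀ q ∈ A.transcript f n, oracle g q.point = oracle f q.point) :
    ∀ m ≤ n, A.transcript g m = A.transcript f m := by
  induction n with
  | zero =>
    rintro m hm
    obtain rfl := Nat.le_zero.1 hm
    rfl
  | succ n ih =>
    have ih' := ih fun q hq => h q (A.transcript_subset_succ f n hq)
    intro m hm
    rcases hm.lt_or_eq with hm | rfl
    · exact ih' m (Nat.lt_succ_iff.1 hm)
    · rw [transcript, ih' n le_rfl]
      rw [transcript] at h ⊢
      rcases hA : A (A.transcript f n) with x | x
      · simp only [hA] at h ⊢
        have hx : oracle g x = oracle f x :=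
          h (oracle f x) (List.mem_append_right _ (List.mem_singleton_self _))
        rw [hx]
      · rfl

lemma OutputsAfter.congr {A : Algorithm d} {n : ℕ} {x : EuclideanSpace ℝ (Fin d)}
    (hA : A.OutputsAfter f n x)
    (h : ∀ q ∈ A.transcript f n, oracle g q.point = oracle f q.point) : A.OutputsAfter g n x := by
  have hc := A.transcript_congr h
  refine ⟨fun m hm => ?_, ?_⟩
  · rw [hc m hm.le]
    exact hA.1 m hm
  · rw [hc n le_rfl]
    exact hA.2

lemma OutputsAfter.unique {A : Algorithm d} {n m : ℕ} {x y : EuclideanSpace ℝ (Fin d)}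
    (hx : A.OutputsAfter f n x) (hy : A.OutputsAfter f m y) : x = y := by
  have hnm : n = m := by
    rcases lt_trichotomy n m with h | h | h
    · simpa [hx.2] using hy.1 n h
    · exact h
    · simpa [hy.2] using hx.1 m h
  subst hnm
  exact Sum.inr_injective (hx.2.symm.trans hy.2)

/-- An algorithm that is correct on all wells makes at least `2 ^ d - 1` queries on the constant
function `1`. -/
lemma two_pow_le_of_outputsAfter_const {A : Algorithm d} {G L ε : ℝ} (hε : ε < 1)
    (hA : A.SolvesLocalMin G L ε √d)
    (hwell : ∀ v ∈ cube d, IsInstance G L (well v)) {n : ℕ} {x : EuclideanSpace ℝ (Fin d)}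
    (hn : A.OutputsAfter (fun _ => 1) n x) : 2 ^ d ≤ n + 1 := by
  by_contra! hlt
  obtain ⟨b, hb⟩ := exists_vertex_far
    (x :: (A.transcript (fun _ => 1) n).map fun q => (q.point : EuclideanSpace ℝ (Fin d)))
    (by simpa using (Nat.succ_le_succ (A.length_transcript_le _ n)).trans_lt hlt)
  have hxb : 1 / 2 ≤ ‖x - vertex b‖ := hb x List.mem_cons_self
  have hrun : A.OutputsAfter (well (vertex b)) n x := hn.congr fun q hq =>
    oracle_well_eq (hb _ (List.mem_cons_of_mem _ (List.mem_map.2 ⟨q, hq, rfl⟩)))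
  obtain ⟨m, y, hy, hmem, hmin⟩ := hA _ (hwell _ (vertex_mem_cube b))
  obtain rfl := hrun.unique hy
  have h := hmin (vertex b) (vertex_mem_cube b) (by
    rw [mem_closedBall_iff_norm]
    exact norm_sub_le_sqrt_of_mem_cube (vertex_mem_cube b) hmem)
  rw [well_eq_one hxb, well_self] at h
  linarith

end Algorithm

end

/-- A positive function of order `d ^ k` with `2 ≤ k` eventually exceeds every multiple of `d`. -/
lemma eventually_mul_le_of_isTheta {F : ℕ → ℝ} {k : ℕ} (hk : 2 ≤ k) (hF : ∀ d, 0 < F d)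
    (h : F =Θ[atTop] fun d : ℕ => (d : ℝ) ^ k) (C : ℝ) :
    ∀ᶠ d : ℕ in atTop, C * (d : ℝ) ≤ F d := by
  have ho : (fun d : ℕ => (d : ℝ)) =o[atTop] fun d : ℕ => (d : ℝ) ^ k := by
    have := (isLittleO_pow_pow_atTop_of_lt (𝕜 := ℝ) (p := 1) (q := k) (by omega)).comp_tendsto
      tendsto_natCast_atTop_atTop
    simpa [Function.comp_def] using this
  have ho' := (ho.trans_isTheta h.symm).const_mul_left C
  filter_upwards [ho'.bound zero_lt_one] with d hd
  rw [one_mul, Real.norm_of_nonneg (hF d).le] at hd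
  exact (Real.le_norm_self _).trans hd

end BlackBox

theorem mainTheorem11 :
    ∃ c : ℝ, 0 < c ∧
      ∀ G L : ℕ → ℝ, (∀ d, 0 < G d) → (∀ d, 0 < L d) →
        (G =Θ[atTop] fun d : ℕ => (d : ℝ) ^ 15) →
        (L =Θ[atTop] fun d : ℕ => (d : ℝ) ^ 22) →
        ∀ᶠ d : ℕ in atTop, ∀ ε : ℝ, 0 < ε → ε < 1 →
          ∀ A : BlackBox.Algorithm d, A.SolvesLocalMin (G d) (L d) ε (Real.sqrt d) →
            ∃ f : EuclideanSpace ℝ (Fin d) → ℝ, BlackBox.IsInstance (G d) (L d) f ∧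
              ∃ (n : ℕ) (x : EuclideanSpace ℝ (Fin d)),
                A.OutputsAfter f n x ∧ c * ((2 : ℝ) ^ d / (d : ℝ)) ≤ (n : ℝ) := by

  -- `2 ^ d - 1` is at least `2 ^ d / 2` for `1 ≤ d`; the factor `1 / d` is not needed.
  refine ⟨1 / 2, by norm_num, fun G L hG hL hGΘ hLΘ => ?_⟩
  filter_upwards [eventually_ge_atTop 1,
    BlackBox.eventually_mul_le_of_isTheta (by norm_num) hG hGΘ 144,
    BlackBox.eventually_mul_le_of_isTheta (by norm_num) hL hLΘ 144] with d hd hGd hLd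
  intro ε _ hε A hA
  have hconst := BlackBox.isInstance_const_one (d := d) (hG d).le (hL d).le
  obtain ⟨n, x, hn, -⟩ := hA _ hconst
  refine ⟨_, hconst, n, x, hn, ?_⟩
  have h : ((2 : ℝ) ^ d) ≤ n + 1 := by
    exact_mod_cast BlackBox.Algorithm.two_pow_le_of_outputsAfter_const hε hA
      (fun v hv => BlackBox.isInstance_well hv hd hGd hLd) hn
  have hd' : (1 : ℝ) ≤ d := by exact_mod_cast hd
  have h2 : (2 : ℝ) ≤ 2 ^ d := by
    simpa using pow_le_pow_right₀ (one_le_two : (1 : ℝ) ≤ 2) hd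
  have hdiv : (2 : ℝ) ^ d / d ≤ 2 ^ d := div_le_self (by positivity) hd'
  linarith
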